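/- Let $\mathfrak{M}$ be a monster model of the theory of (nontrivial) atomless Boolean algebras in the signature $\{0,1,\wedge,\vee,\neg\}$, i.e. a nontrivial atomless Boolean algebra which is $\kappa$-saturated and strongly $\kappa$-homogeneous for some uncountable cardinal $\kappa$. Let $\mathcal{A},\mathcal{B},\mathcal{C}$ be subalgebras of $\mathfrak{M}$ with $\mathcal{C}$ small (that is, $|\mathcal{C}|<\kappa$) and atomic, and suppose that $\mathcal{C}$ sits nicely in both $\mathcal{A}$ and $\mathcal{B}$. Here $\mathcal{C}$ sits nicely in $\mathcal{A}$ if $\mathcal{C}\subseteq\mathcal{A}$, every supremum of a family of elements of $\mathcal{C}$ that exists in $\mathcal{C}$ is also its supremum in $\mathcal{A}$, and for every $a\in\mathcal{A}$ there is a least $c\in\mathcal{C}$ with $a\le c$. Then the following are equivalent: 1. $\mathcal{A}$ is freely amalgamated with $\mathcal{B}$ over $\mathcal{C}$, i.e. the subalgebra $\langle \mathcal{A}\cup \mathcal{B}\rangle$ of $\mathfrak{M}$ together with the inclusions of $\mathcal{A}$ and $\mathcal{B}$ is the pushout $\mathcal{A}\otimes_{\mathcal{C}}\mathcal{B}$ of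 $\mathcal{A}$ and $\mathcal{B}$ over $\mathcal{C}$ in the category of Boolean algebras; 2. every $a\in\mathcal{A}$ is dividing independent from every $b\in\mathcal{B}$ over $\mathcal{C}$, i.e. for every sequence $(b_i)_{i<\omega}$ of elements of $\mathfrak{M}$ that is indiscernible over $\mathcal{C}$ with $b_0=b$ there is $a'\in\mathfrak{M}$ such that $\mathrm{tp}(a'/\mathcal{C}b)=\mathrm{tp}(a/\mathcal{C}b)$ and $(b_i)_{i<\omega}$ is indiscernible over $\mathcal{C}a'$. -/

import Mathlib

universe u v w

open FirstOrder CategoryTheory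
open scoped FirstOrder Cardinal

/-! ### Model theory -/

section ModelTheory

variable (L : FirstOrder.Language.{u, v}) {M : Type w} [L.Structure M]

/-- The complete type `tp(a/C)` of a tuple `a` over a set of parameters `C`. -/
noncomputable def tp [Nonempty M] (C : Set M) {n : ℕ} (a : Fin n → M) :
    (L[[C]].completeTheory M).CompleteType (Fin n) :=
  (L[[C]].completeTheory M).typeOf a

/-- The sequence `(b i)` of `m`-tuples, `i < ω`, is (order-)indiscernible over `C`: any two finite
subsequences of the same length satisfy the same formulas with parameters in `C`. -/
def IndiscernibleOver (C : Set M) {m : ℕ} (b : ℕ → Fin m → M) : Prop :=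
  ∀ (k : ℕ) (i j : Fin k ↪o ℕ) (φ : L[[C]].Formula (Fin k × Fin m)),
    φ.Realize (fun p => b (i p.1) p.2) ↔ φ.Realize (fun p => b (j p.1) p.2)

/-- `a` is dividing independent from `b` over `C`, computed in `M`. -/
def DivIndep [Nonempty M] (C : Set M) {n m : ℕ} (a : Fin n → M) (b : Fin m → M) : Prop :=
  ∀ s : ℕ → Fin m → M, IndiscernibleOver L C s → s 0 = b →
    ∃ a' : Fin n → M,
      tp L (C ∪ Set.range b) a' = tp L (C ∪ Set.range b) a ∧
      IndiscernibleOver L (C ∪ Set.range a') s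

variable (M) in
/-- `M` is `κ`-saturated: every set of formulas in one variable over fewer than `κ` parameters
which is finitely satisfiable in `M` is realized in `M`. -/
def IsSaturatedModel (κ : Cardinal.{w}) : Prop :=
  ∀ C : Set M, #C < κ → ∀ p : Set (L[[C]].Formula (Fin 1)),
    (∀ Γ : Finset (L[[C]].Formula (Fin 1)), (Γ : Set (L[[C]].Formula (Fin 1))) ⊆ p →
      ∃ x : Fin 1 → M, ∀ φ ∈ Γ, φ.Realize x) →
    ∃ x : Fin 1 → M, ∀ φ ∈ p, φ.Realize x

variable (M) in
/-- `M` is strongly `κ`-homogeneous: every partial elementary map defined on fewer than `κ`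
elements extends to an automorphism of `M`. -/
def IsStronglyHomogeneousModel (κ : Cardinal.{w}) : Prop :=
  ∀ (S : Set M) (f : S → M), #S < κ →
    (∀ φ : L.Formula S, φ.Realize ((↑) : S → M) ↔ φ.Realize f) →
    ∃ σ : M ≃[L] M, ∀ s : S, σ s = f s

end ModelTheory

/-! ### Boolean algebras as first-order structures -/

/-- The function symbols `0, 1, ∧, ∨, ¬`. -/
inductive BoolFunc : ℕ → Type
  | zero : BoolFunc 0
  | one : BoolFunc 0
  | and : BoolFunc 2
  | or : BoolFunc 2
  | not : BoolFunc 1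

/-- The signature `{0, 1, ∧, ∨, ¬}`. -/
def boolLang : FirstOrder.Language.{0, 0} where
  Functions := BoolFunc
  Relations := fun _ => Empty

/-- Every Boolean algebra is a structure in the signature `{0, 1, ∧, ∨, ¬}`. -/
instance boolStructure {M : Type u} [BooleanAlgebra M] : boolLang.Structure M where
  funMap := fun {_} f x =>
    match f, x with
    | BoolFunc.zero, _ => ⊥
    | BoolFunc.one, _ => ⊤
    | BoolFunc.and, x => x 0 ⊓ x 1
    | BoolFunc.or, x => x 0 ⊔ x 1
    | BoolFunc.not, x => (x 0)ᶜ
  RelMap := fun r _ => nomatch r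

/-- `M` is a monster model, with uncountable degree of saturation and homogeneity `κ`, of the
theory of (nontrivial) atomless Boolean algebras. -/
structure IsMonsterABA (M : Type u) [BooleanAlgebra M] (κ : Cardinal.{u}) : Prop where
  nontrivial : Nontrivial M
  atomless : ∀ x : M, ¬ IsAtom x
  uncountable : ℵ₀ < κ
  saturated : IsSaturatedModel boolLang M κ
  homogeneous : IsStronglyHomogeneousModel boolLang M κ

/-! ### Subalgebras -/

section Subalgebras

variable {D : Type u} [BooleanAlgebra D]

/-- `C` is a regular subalgebra of `A`: suprema computed in `C` are also suprema in `A`. -/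
def IsRegularIn {C A : BooleanSubalgebra D} (h : C ≤ A) : Prop :=
  ∀ (S : Set C) (s : C), IsLUB S s →
    IsLUB (BooleanSubalgebra.inclusion h '' S) (BooleanSubalgebra.inclusion h s)

/-- `C` sits nicely in `A`. -/
structure SitsNicely (C A : BooleanSubalgebra D) : Prop where
  le : C ≤ A
  regular : IsRegularIn le
  exists_least : ∀ a ∈ A, ∃ c, IsLeast {c : D | c ∈ C ∧ a ≤ c} c

/-- `A` and `B` are freely amalgamated over `C`: the subalgebra `⟨A ∪ B⟩`, with the inclusions of
`A` and `B`, is the pushout of `A` and `B` over `C` in the category of Boolean algebras. -/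
def FreelyAmalgamated {C A B : BooleanSubalgebra D} (hA : C ≤ A) (hB : C ≤ B) : Prop :=
  IsPushout
    (BoolAlg.ofHom (BooleanSubalgebra.inclusion hA))
    (BoolAlg.ofHom (BooleanSubalgebra.inclusion hB))
    (BoolAlg.ofHom (BooleanSubalgebra.inclusion
      (Set.subset_union_left.trans BooleanSubalgebra.subset_closure :
        A ≤ BooleanSubalgebra.closure ((A : Set D) ∪ B))))
    (BoolAlg.ofHom (BooleanSubalgebra.inclusion
      (Set.subset_union_right.trans BooleanSubalgebra.subset_closure :
        B ≤ BooleanSubalgebra.closure ((A : Set D) ∪ B))))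

end Subalgebras

/-!
Free amalgamation and dividing independence are both compared with a third condition,
`AtomwiseIndependent`: elements of `A` and `B` that meet the same atom of `C` meet each other.

*Free amalgamation.* An element `e` of `C` separates disjoint `a ∈ A` and `b ∈ B` if `a ≤ e` and
`b ⊓ e = ⊥`. Homomorphisms on `A` and `B` that agree on `C` extend to `⟨A ∪ B⟩` as soon as all
disjoint pairs are separated (`exists_hom_closure`); testing against ultrafilters reduces this to
the Boolean prime ideal theorem. If `C` is atomic and closures in `C` exist, atomwise independence
yields separation, by the least element of `C` above `a`. Conversely, if `a` and `b` both meet an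
atom `c` of `C`, ultrafilters containing `a ⊓ c` and `b ⊓ c` agree on `C`, and the pushout property
gives `a ⊓ b ≠ ⊥`.

*Types.* In a saturated atomless Boolean algebra every cut over a small set of parameters is
realized (`exists_cut`), so a back-and-forth argument shows that the type of a small tuple is
determined by the Boolean terms that vanish at it (`SameVanishing.formula_iff`). Equality of types
and indiscernibility thereby become statements about vanishing of terms.

*Dividing.* Under atomwise independence, `a` is disjoint from an element of `B` if and only if the
least `e ∈ C` above `a` is, and similarly for `aᶜ` and the least `f` above it. An `a'` that relates
in this way to all elements spanned by `C` and the given sequence has the type of `a` over `C` and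
`b`, and the sequence stays indiscernible over it, as all conditions on `a'` have been expressed by
`e, f ∈ C` (`AtomwiseIndependent.divIndep`). If atomwise independence fails, there are disjoint
nonzero `a ∈ A` and `b ∈ B` below an atom `c` of `C`. The complements in `c` of a disjoint sequence
of elements below `c` starting with `c \ b` form an indiscernible sequence over `C` starting with
`b`; nothing nonzero below `c` is disjoint from two of its members
(`not_divIndep_of_isAtom`).
-/

/-! ### Boolean terms -/

section BooleanTerms

variable {M : Type u} [BooleanAlgebra M] {β : Type v} {γ : Type w}

/-- The term `0`. -/
def botTerm : boolLang.Term β :=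
  Language.Constants.term (L := boolLang) (BoolFunc.zero : boolLang.Functions 0)

/-- The term `t ∧ s`. -/
def infTerm (t s : boolLang.Term β) : boolLang.Term β :=
  Language.Functions.apply₂ (L := boolLang) (BoolFunc.and : boolLang.Functions 2) t s

/-- The term `t ∨ s`. -/
def supTerm (t s : boolLang.Term β) : boolLang.Term β :=
  Language.Functions.apply₂ (L := boolLang) (BoolFunc.or : boolLang.Functions 2) t s

/-- The term `¬t`. -/
def complTerm (t : boolLang.Term β) : boolLang.Term β :=
  Language.Functions.apply₁ (L := boolLang) (BoolFunc.not : boolLang.Functions 1) t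

@[simp] lemma realize_botTerm (v : β → M) : (botTerm : boolLang.Term β).realize v = ⊥ := rfl

@[simp] lemma realize_infTerm (v : β → M) (t s : boolLang.Term β) :
    (infTerm t s).realize v = t.realize v ⊓ s.realize v := rfl

@[simp] lemma realize_supTerm (v : β → M) (t s : boolLang.Term β) :
    (supTerm t s).realize v = t.realize v ⊔ s.realize v := rfl

@[simp] lemma realize_complTerm (v : β → M) (t : boolLang.Term β) :
    (complTerm t).realize v = (t.realize v)ᶜ := rfl

/-- Induction on terms, seen through their values: a property of `β`-ary operations which holds for
projections and the constants and is closed under `⊓`, `⊔` and `ᶜ` holds for all terms. -/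
lemma realize_induction {p : ((β → M) → M) → Prop} (hvar : ∀ x, p fun v => v x)
    (hbot : p fun _ => ⊥) (htop : p fun _ => ⊤)
    (hinf : ∀ f g, p f → p g → p fun v => f v ⊓ g v)
    (hsup : ∀ f g, p f → p g → p fun v => f v ⊔ g v)
    (hcompl : ∀ f, p f → p fun v => (f v)ᶜ) (t : boolLang.Term β) :
    p fun v => t.realize v := by
  induction t with
  | var x => exact hvar x
  | func f ts ih =>
    cases f with
    | zero => exact hbot
    | one => exact htop
    | and => exact hinf _ _ (ih 0) (ih 1)
    | or => exact hsup _ _ (ih 0) (ih 1)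
    | not => exact hcompl _ (ih 0)

/-- A Boolean term depends on the variables sent to `none` by `g` through their common value `z`
only, and is the disjunction of its two specialisations at `z = 1` and `z = 0`. -/
lemma exists_realize_eq_sup (g : γ → Option β) (t : boolLang.Term γ) :
    ∃ t₁ t₀ : boolLang.Term β, ∀ (v : β → M) (z : M),
      t.realize (fun x => (g x).elim z v) = (z ⊓ t₁.realize v) ⊔ (zᶜ ⊓ t₀.realize v) := by
  induction t with
  | var x =>
    rcases h : g x with _ | b
    · exact ⟨complTerm botTerm, botTerm, fun v z => by simp [h]⟩
    · exact ⟨.var b, .var b, fun v z => by simp [h, ← inf_sup_right]⟩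
  | func f ts ih =>
    cases f with
    | zero => exact ⟨botTerm, botTerm, fun v z => by simp; rfl⟩
    | one => exact ⟨complTerm botTerm, complTerm botTerm, fun v z => by simp; rfl⟩
    | and =>
      obtain ⟨a₁, a₀, ha⟩ := ih 0
      obtain ⟨b₁, b₀, hb⟩ := ih 1
      refine ⟨infTerm a₁ b₁, infTerm a₀ b₀, fun v z => ?_⟩
      change Language.Term.realize _ (ts 0) ⊓ Language.Term.realize _ (ts 1) = _
      rw [ha, hb, inf_sup_right, inf_sup_left, inf_sup_left, inf_inf_inf_comm z _ z,
        inf_inf_inf_comm z _ zᶜ, inf_inf_inf_comm zᶜ _ z, inf_inf_inf_comm zᶜ _ zᶜ]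
      simp
    | or =>
      obtain ⟨a₁, a₀, ha⟩ := ih 0
      obtain ⟨b₁, b₀, hb⟩ := ih 1
      refine ⟨supTerm a₁ b₁, supTerm a₀ b₀, fun v z => ?_⟩
      change Language.Term.realize _ (ts 0) ⊔ Language.Term.realize _ (ts 1) = _
      rw [ha, hb, realize_supTerm, realize_supTerm, inf_sup_left, inf_sup_left, sup_sup_sup_comm]
    | not =>
      obtain ⟨a₁, a₀, ha⟩ := ih 0
      refine ⟨complTerm a₁, complTerm a₀, fun v z => ?_⟩
      change (Language.Term.realize _ (ts 0))ᶜ = _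
      rw [ha, realize_complTerm, realize_complTerm]
      refine (IsCompl.of_eq ?_ ?_).compl_eq
      · rw [inf_sup_right, inf_sup_left, inf_sup_left, inf_inf_inf_comm z _ z,
          inf_inf_inf_comm z _ zᶜ, inf_inf_inf_comm zᶜ _ z, inf_inf_inf_comm zᶜ _ zᶜ]
        simp
      · rw [sup_sup_sup_comm, ← inf_sup_left, ← inf_sup_left]
        simp

/-- The value of a term relative to `p` only depends on the arguments relative to `p`. -/
lemma realize_inf_congr {v w : β → M} {p : M} (h : ∀ x, v x ⊓ p = w x ⊓ p)
    (t : boolLang.Term β) : t.realize v ⊓ p = t.realize w ⊓ p := by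
  refine realize_induction (p := fun f => f v ⊓ p = f w ⊓ p) h rfl rfl ?_ ?_ ?_ t
  · intro f g hf hg
    rw [inf_inf_distrib_right, hf, hg, ← inf_inf_distrib_right]
  · intro f g hf hg
    rw [inf_sup_right, hf, hg, ← inf_sup_right]
  · intro f hf
    have key (x : M) : xᶜ ⊓ p = p \ (x ⊓ p) := by
      rw [sdiff_inf_self_right, sdiff_eq, inf_comm]
    change (f v)ᶜ ⊓ p = (f w)ᶜ ⊓ p
    rw [key, hf, ← key]

lemma realize_eq_bot_or_eq_top {v : β → M} (h : ∀ x, v x = ⊥ ∨ v x = ⊤)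
    (t : boolLang.Term β) : t.realize v = ⊥ ∨ t.realize v = ⊤ := by
  refine realize_induction (p := fun f => f v = ⊥ ∨ f v = ⊤) h (.inl rfl) (.inr rfl) ?_ ?_ ?_ t
  · rintro f g (hf | hf) (hg | hg) <;> simp [hf, hg]
  · rintro f g (hf | hf) (hg | hg) <;> simp [hf, hg]
  · rintro f (hf | hf) <;> simp [hf]

lemma realize_mem {D : BooleanSubalgebra M} {v : β → M} (h : ∀ x, v x ∈ D)
    (t : boolLang.Term β) : t.realize v ∈ D :=
  realize_induction (p := fun f => f v ∈ D) h D.bot_mem D.top_mem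
    (fun _ _ => D.inf_mem) (fun _ _ => D.sup_mem) (fun _ => D.compl_mem) t

/-- Two tuples have the same quantifier-free type: a Boolean term vanishes at one of them if and
only if it vanishes at the other. -/
def SameVanishing (v w : β → M) : Prop :=
  ∀ t : boolLang.Term β, t.realize v = ⊥ ↔ t.realize w = ⊥

lemma SameVanishing.realize_eq_iff {v w : β → M} (h : SameVanishing v w)
    (t s : boolLang.Term β) : t.realize v = s.realize v ↔ t.realize w = s.realize w := by
  have key (x : β → M) : t.realize x = s.realize x ↔
      (supTerm (infTerm t (complTerm s)) (infTerm s (complTerm t))).realize x = ⊥ := by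
    simp only [realize_supTerm, realize_infTerm, realize_complTerm, ← sdiff_eq]
    exact symmDiff_eq_bot.symm
  rw [key, key, h]

end BooleanTerms

/-! ### Realizing cuts over a small set of parameters -/

section Cuts

variable {M : Type u} [BooleanAlgebra M] {κ : Cardinal.{u}} {β : Type u} {γ : Type w}

lemma exists_lt_lt_of_atomless (hM : ∀ x : M, ¬ IsAtom x) {e : M} (he : e ≠ ⊥) :
    ∃ x, x ≠ ⊥ ∧ x < e := by
  by_contra! h
  exact hM e ⟨he, fun x hx => by_contra fun h' => h x h' hx⟩

/-- Finitely many of the conditions defining a cut can be met: split `e` along the given elements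
one after the other, and at the end put each piece into `x` or into `y`, or a proper part of it into
either, as `P` and `Q` demand. -/
lemma exists_cut_of_finset (hM : ∀ x : M, ¬ IsAtom x) {D : BooleanSubalgebra M} {P Q : M → Prop}
    (hP : ∀ d ∈ D, ∀ e ∈ D, P (d ⊔ e) ↔ P d ∧ P e)
    (hQ : ∀ d ∈ D, ∀ e ∈ D, Q (d ⊔ e) ↔ Q d ∧ Q e) (hP₀ : P ⊥) (hQ₀ : Q ⊥)
    (hPQ : ∀ d ∈ D, P d → Q d → d = ⊥) (F : Finset M) (hF : (F : Set M) ⊆ D) :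
    ∀ e ∈ D, ∃ x y, Disjoint x y ∧ x ⊔ y = e ∧ ((x = ⊥ ↔ P e) ∧ (y = ⊥ ↔ Q e)) ∧
      ∀ d ∈ F, (x ⊓ d = ⊥ ↔ P (e ⊓ d)) ∧ (y ⊓ d = ⊥ ↔ Q (e ⊓ d)) := by
  classical
  induction F using Finset.induction_on with
  | empty =>
    intro e he
    by_cases hb : e = ⊥
    · subst hb
      exact ⟨⊥, ⊥, disjoint_bot_left, by simp, by simp [hP₀, hQ₀], by simp⟩
    by_cases h₁ : P e
    · have h₂ : ¬ Q e := fun h => hb (hPQ e he h₁ h)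
      exact ⟨⊥, e, disjoint_bot_left, by simp, by simp [h₁, h₂, hb], by simp⟩
    by_cases h₂ : Q e
    · exact ⟨e, ⊥, disjoint_bot_right, by simp, by simp [h₁, h₂, hb], by simp⟩
    obtain ⟨x, hx, hxe⟩ := exists_lt_lt_of_atomless hM hb
    refine ⟨x, e \ x, disjoint_sdiff_self_right, sup_sdiff_cancel_right hxe.le,
      ⟨by simp [hx, h₁], ?_⟩, by simp⟩
    simp only [h₂, iff_false, sdiff_eq_bot_iff]
    exact hxe.not_ge
  | insert a F _ ih =>
    rw [Finset.coe_insert, Set.insert_subset_iff] at hF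
    obtain ⟨ha, hF⟩ := hF
    have ha' : aᶜ ∈ D := D.compl_mem ha
    intro e he
    obtain ⟨x, y, hxy, hxy', ⟨hx₁, hy₁⟩, hx⟩ := ih hF _ (D.inf_mem he ha)
    obtain ⟨x', y', hxy₂, hxy₂', ⟨hx₁', hy₁'⟩, hx'⟩ := ih hF _ (D.inf_mem he ha')
    have hsplit (d : M) : e ⊓ d = (e ⊓ a ⊓ d) ⊔ (e ⊓ aᶜ ⊓ d) := by
      rw [← inf_sup_right, ← inf_sup_left]; simp
    have hsplit' : e = (e ⊓ a) ⊔ (e ⊓ aᶜ) := by rw [← inf_sup_left]; simp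
    have hxa : x ⊔ y ≤ a := hxy'.trans_le inf_le_right
    have hxa' : x' ⊔ y' ≤ aᶜ := hxy₂'.trans_le inf_le_right
    rw [sup_le_iff] at hxa hxa'
    have hdisj : Disjoint a aᶜ := disjoint_compl_right
    refine ⟨x ⊔ x', y ⊔ y', ?_, ?_, ⟨?_, ?_⟩, ?_⟩
    · rw [disjoint_sup_left, disjoint_sup_right, disjoint_sup_right]
      exact ⟨⟨hxy, hdisj.mono hxa.1 hxa'.2⟩, (hdisj.mono hxa.2 hxa'.1).symm, hxy₂⟩
    · rw [sup_sup_sup_comm, hxy', hxy₂', ← hsplit']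
    · rw [sup_eq_bot_iff, hx₁, hx₁', ← hP _ (D.inf_mem he ha) _ (D.inf_mem he ha'), ← hsplit']
    · rw [sup_eq_bot_iff, hy₁, hy₁', ← hQ _ (D.inf_mem he ha) _ (D.inf_mem he ha'), ← hsplit']
    · intro d hd
      rw [Finset.mem_insert] at hd
      obtain rfl | hd := hd
      · rw [inf_sup_right, inf_sup_right, inf_eq_left.2 hxa.1, inf_eq_left.2 hxa.2,
          (hdisj.mono_right hxa'.1).symm.eq_bot, (hdisj.mono_right hxa'.2).symm.eq_bot]
        simp [hx₁, hy₁]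
      · have h₁ : e ⊓ a ⊓ d ∈ D := D.inf_mem (D.inf_mem he ha) (hF hd)
        have h₂ : e ⊓ aᶜ ⊓ d ∈ D := D.inf_mem (D.inf_mem he ha') (hF hd)
        rw [hsplit, inf_sup_right, inf_sup_right, sup_eq_bot_iff, sup_eq_bot_iff, hP _ h₁ _ h₂,
          hQ _ h₁ _ h₂, (hx d hd).1, (hx d hd).2, (hx' d hd).1, (hx' d hd).2]
        exact ⟨Iff.rfl, Iff.rfl⟩

lemma realize_iff_constantsVarsEquiv {S : Set M} (φ : boolLang[[S]].Formula γ) (v : γ → M) :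
    φ.Realize v ↔
      Language.Formula.Realize (L := boolLang) (Language.BoundedFormula.constantsVarsEquiv φ)
        (Sum.elim (fun s : S => (s : M)) v) :=
  Language.BoundedFormula.realize_constantsVarsEquiv.symm

lemma exists_formula_realize_iff {S : Set M} (ψ : boolLang.Formula (S ⊕ γ)) :
    ∃ φ : boolLang[[S]].Formula γ, ∀ v : γ → M,
      φ.Realize v ↔ ψ.Realize (Sum.elim (fun s => (s : M)) v) :=
  ⟨Language.BoundedFormula.constantsVarsEquiv.symm ψ, fun v => by
    rw [realize_iff_constantsVarsEquiv, Equiv.apply_symm_apply]⟩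

lemma mk_range_realize_lt (hκ : ℵ₀ < κ) (w : β → M) (hβ : #β < κ) :
    #(Set.range fun t : boolLang.Term β => t.realize w) < κ := by
  have : Countable (Σ i, boolLang.Functions i) := by
    change Countable (Σ i, BoolFunc i)
    have : ∀ i, Countable (BoolFunc i) := fun i => by
      have : Function.Injective (fun f : BoolFunc i =>
          (match f with | .zero => 0 | .one => 1 | .and => 2 | .or => 3 | .not => 4 : ℕ)) := by
        intro f g h
        cases f <;> cases g <;> simp_all
      exact this.countable
    infer_instance
  refine Cardinal.mk_range_le.trans_lt (Language.Term.card_le.trans_lt ?_)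
  rw [max_lt_iff, Cardinal.mk_sum]
  refine ⟨hκ, Cardinal.add_lt_of_lt hκ.le (by simpa using hβ) ?_⟩
  refine lt_of_le_of_lt ?_ hκ
  rw [Cardinal.lift_le_aleph0]
  exact Cardinal.mk_le_aleph0

/-- The subalgebra of values of terms at a tuple. -/
def spanTuple (w : β → M) : BooleanSubalgebra M where
  carrier := Set.range fun t : boolLang.Term β => t.realize w
  supClosed' := by rintro _ ⟨t, rfl⟩ _ ⟨s, rfl⟩; exact ⟨supTerm t s, rfl⟩
  infClosed' := by rintro _ ⟨t, rfl⟩ _ ⟨s, rfl⟩; exact ⟨infTerm t s, rfl⟩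
  bot_mem' := ⟨botTerm, rfl⟩
  compl_mem' := by rintro _ ⟨t, rfl⟩; exact ⟨complTerm t, rfl⟩

/-- Over a small tuple of parameters, saturation realizes every cut: given two ideals `P` and `Q` of
the subalgebra `D` spanned by the parameters with `P ∩ Q = 0`, there is an `x` such that `P` and `Q`
consist of the elements of `D` disjoint from `x` and from `xᶜ`, respectively. -/
lemma exists_cut (hM : IsMonsterABA M κ) (w : β → M) (hβ : #β < κ) {P Q : M → Prop}
    (hP : ∀ d ∈ spanTuple w, ∀ e ∈ spanTuple w, P (d ⊔ e) ↔ P d ∧ P e)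
    (hQ : ∀ d ∈ spanTuple w, ∀ e ∈ spanTuple w, Q (d ⊔ e) ↔ Q d ∧ Q e) (hP₀ : P ⊥) (hQ₀ : Q ⊥)
    (hPQ : ∀ d ∈ spanTuple w, P d → Q d → d = ⊥) :
    ∃ x, ∀ d ∈ spanTuple w, (x ⊓ d = ⊥ ↔ P d) ∧ (xᶜ ⊓ d = ⊥ ↔ Q d) := by
  classical
  set S : Set M := (spanTuple w : Set M)
  have hS : #S < κ := mk_range_realize_lt hM.uncountable w hβ
  have hcond (d : S) : ∃ φ : boolLang[[S]].Formula (Fin 1), ∀ v : Fin 1 → M,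
      φ.Realize v ↔ (v 0 ⊓ d = ⊥ ↔ P d) ∧ ((v 0)ᶜ ⊓ d = ⊥ ↔ Q d) := by
    let z : boolLang.Term (S ⊕ Fin 1) := .var (.inr 0)
    let c : boolLang.Term (S ⊕ Fin 1) := .var (.inl d)
    let θ (p : Prop) (ψ : boolLang.Formula (S ⊕ Fin 1)) : boolLang.Formula (S ⊕ Fin 1) :=
      if p then ψ else ψ.not
    have hθ (p : Prop) (ψ) (v : S ⊕ Fin 1 → M) : (θ p ψ).Realize v ↔ (ψ.Realize v ↔ p) := by
      by_cases hp : p <;> simp [θ, hp, Language.Formula.realize_not]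
    obtain ⟨φ, hφ⟩ := exists_formula_realize_iff (γ := Fin 1)
      (θ (P d) ((infTerm z c).equal botTerm) ⊓ θ (Q d) ((infTerm (complTerm z) c).equal botTerm))
    refine ⟨φ, fun v => ?_⟩
    rw [hφ, Language.Formula.realize_inf, hθ, hθ]
    simp [z, c]
  choose φ hφ using hcond
  have hfin (Γ : Finset (boolLang[[S]].Formula (Fin 1))) (hΓ : (Γ : Set _) ⊆ Set.range φ) :
      ∃ x : Fin 1 → M, ∀ ψ ∈ Γ, ψ.Realize x := by
    rw [← Set.image_univ] at hΓ
    obtain ⟨F, -, rfl⟩ := Finset.subset_set_image_iff.1 hΓ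
    obtain ⟨x, y, hxy, hxy', -, h⟩ := exists_cut_of_finset hM.atomless hP hQ hP₀ hQ₀ hPQ
      (F.image (↑)) (by rw [Finset.coe_image]; rintro _ ⟨d, -, rfl⟩; exact d.2) ⊤
      (spanTuple w).top_mem
    have hy : xᶜ = y := (IsCompl.of_eq hxy.eq_bot hxy').compl_eq
    refine ⟨fun _ => x, fun ψ hψ => ?_⟩
    rw [Finset.mem_image] at hψ
    obtain ⟨d, hd, rfl⟩ := hψ
    rw [hφ, hy]
    simpa using h d (Finset.mem_image_of_mem _ hd)
  obtain ⟨x, hx⟩ := hM.saturated S hS (Set.range φ) hfin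
  exact ⟨x 0, fun d hd => (hφ ⟨d, hd⟩ x).1 (hx _ ⟨_, rfl⟩)⟩

end Cuts

/-! ### Quantifier elimination -/

section QuantifierElimination

variable {M : Type u} [BooleanAlgebra M] {κ : Cardinal.{u}} {β γ : Type u}

/-- If the variables sent to `none` by `g` take the value `z` in `v` and `z'` in `w`, it suffices to
compare which elements spanned by the other variables are disjoint from `z`, `zᶜ` and from `z'`,
`z'ᶜ`. -/
lemma sameVanishing_of_split {β γ : Type*} {v w : β → M} {z z' : M} (g : γ → Option β)
    (h : ∀ t : boolLang.Term β, (z ⊓ t.realize v = ⊥ ↔ z' ⊓ t.realize w = ⊥) ∧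
      (zᶜ ⊓ t.realize v = ⊥ ↔ z'ᶜ ⊓ t.realize w = ⊥)) :
    SameVanishing (fun x => (g x).elim z v) (fun x => (g x).elim z' w) := by
  intro t
  obtain ⟨t₁, t₀, ht⟩ := exists_realize_eq_sup (M := M) g t
  rw [ht, ht, sup_eq_bot_iff, sup_eq_bot_iff, (h t₁).1, (h t₀).2]

/-- The extension step of the back-and-forth argument. -/
lemma SameVanishing.exists_extend (hM : IsMonsterABA M κ) (hβ : #β < κ) {v w : β → M}
    (h : SameVanishing v w) (g : γ → Option β) (z : M) :
    ∃ z', SameVanishing (fun x => (g x).elim z v) (fun x => (g x).elim z' w) := by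
  have hv {t s : boolLang.Term β} (hts : t.realize w = s.realize w) :
    t.realize v = s.realize v := (h.realize_eq_iff t s).2 hts
  let R (z : M) (d : M) : Prop := ∀ t : boolLang.Term β, t.realize w = d → z ⊓ t.realize v = ⊥
  have hR (z : M) (t : boolLang.Term β) : R z (t.realize w) ↔ z ⊓ t.realize v = ⊥ :=
    ⟨fun H => H t rfl, fun H s hs => by rw [hv hs, H]⟩
  have hsup (z : M) : ∀ d ∈ spanTuple w, ∀ e ∈ spanTuple w, R z (d ⊔ e) ↔ R z d ∧ R z e := by
    rintro _ ⟨t, rfl⟩ _ ⟨s, rfl⟩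
    change R z ((supTerm t s).realize w) ↔ R z (t.realize w) ∧ R z (s.realize w)
    rw [hR, hR, hR, realize_supTerm, inf_sup_left, sup_eq_bot_iff]
  have hbot (z : M) : R z ⊥ := (hR z botTerm).2 (by simp)
  obtain ⟨z', hz'⟩ := exists_cut hM w hβ (P := R z) (Q := R zᶜ) (hsup _) (hsup _) (hbot _) (hbot _)
    (by
      rintro _ ⟨t, rfl⟩ h₁ h₂
      rw [← h t]
      have := sup_eq_bot_iff.2 ⟨(hR z t).1 h₁, (hR zᶜ t).1 h₂⟩
      rwa [← inf_sup_right, sup_compl_eq_top, top_inf_eq] at this)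
  refine ⟨z', sameVanishing_of_split g fun t => ?_⟩
  rw [← hR, ← hR, (hz' _ ⟨t, rfl⟩).1, (hz' _ ⟨t, rfl⟩).2]
  exact ⟨Iff.rfl, Iff.rfl⟩

lemma SameVanishing.boundedFormula_iff (hM : IsMonsterABA M κ) (hβ : #β < κ) {n : ℕ}
    (φ : boolLang.BoundedFormula β n) :
    ∀ (v w : β → M) (xs ys : Fin n → M), SameVanishing (Sum.elim v xs) (Sum.elim w ys) →
      (φ.Realize v xs ↔ φ.Realize w ys) := by
  induction φ with
  | falsum => exact fun _ _ _ _ _ => Iff.rfl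
  | equal t s => exact fun _ _ _ _ h => h.realize_eq_iff t s
  | rel R => exact R.elim
  | imp _ _ ih₁ ih₂ => exact fun v w xs ys h => imp_congr (ih₁ v w xs ys h) (ih₂ v w xs ys h)
  | @all n φ ih =>
    have hcard : #(β ⊕ Fin n) < κ := by
      rw [Cardinal.mk_sum]
      refine Cardinal.add_lt_of_lt hM.uncountable.le (by simpa using hβ) ?_
      simpa using (Cardinal.natCast_lt_aleph0).trans hM.uncountable
    -- the last bound variable is the new one
    let g : β ⊕ Fin (n + 1) → Option (β ⊕ Fin n) :=
      Sum.elim (fun b => some (.inl b)) (Fin.lastCases none fun i => some (.inr i))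
    have hg (v : β → M) (xs : Fin n → M) (z : M) :
        (fun x => (g x).elim z (Sum.elim v xs)) = Sum.elim v (Fin.snoc xs z : Fin (n + 1) → M) := by
      funext x
      rcases x with b | i
      · rfl
      · refine Fin.lastCases ?_ (fun i => ?_) i <;> simp [g]
    have key (v w : β → M) (xs ys : Fin n → M) (h : SameVanishing (Sum.elim v xs) (Sum.elim w ys))
        (hv : φ.all.Realize v xs) : φ.all.Realize w ys := by
      intro z
      obtain ⟨z', hz'⟩ := SameVanishing.exists_extend hM hcard (fun t => (h t).symm) g z
      rw [hg, hg] at hz'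
      exact (ih v w _ _ fun t => (hz' t).symm).1 (hv z')
    exact fun v w xs ys h => ⟨key v w xs ys h, key w v ys xs fun t => (h t).symm⟩

/-- Quantifier elimination: the type of a small tuple is determined by the vanishing of Boolean
terms. -/
theorem SameVanishing.formula_iff (hM : IsMonsterABA M κ) (hβ : #β < κ) {v w : β → M}
    (h : SameVanishing v w) (φ : boolLang.Formula β) : φ.Realize v ↔ φ.Realize w := by
  refine SameVanishing.boundedFormula_iff hM hβ φ v w _ _ fun t => ?_
  let g : β ⊕ Fin 0 → β := Sum.elim id Fin.elim0
  have hg (v : β → M) (xs : Fin 0 → M) : Sum.elim v xs = v ∘ g := by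
    funext x
    rcases x with b | i
    · rfl
    · exact i.elim0
  rw [hg, hg, ← Language.Term.realize_relabel, ← Language.Term.realize_relabel]
  exact h _

end QuantifierElimination

/-! ### Types and indiscernibility in terms of vanishing terms -/

section Types

variable {M : Type u} [BooleanAlgebra M] {κ : Cardinal.{u}}

lemma tp_eq_iff {L : FirstOrder.Language.{v, w}} {N : Type u} [L.Structure N] [Nonempty N]
    (C : Set N) {n : ℕ} {a a' : Fin n → N} :
    tp L C a = tp L C a' ↔ ∀ φ : L[[C]].Formula (Fin n), φ.Realize a ↔ φ.Realize a' := by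
  refine ⟨fun h φ => ?_, fun h => SetLike.ext fun φ => ?_⟩
  · rw [← Language.Theory.CompleteType.formula_mem_typeOf (T := L[[C]].completeTheory N),
      ← Language.Theory.CompleteType.formula_mem_typeOf (T := L[[C]].completeTheory N)]
    exact iff_of_eq (congrArg (fun p => Language.Formula.equivSentence φ ∈ p) h)
  · exact (Language.Theory.CompleteType.mem_typeOf).trans
      ((h _).trans (Language.Theory.CompleteType.mem_typeOf).symm)

/-- The tuple enumerating the parameters in `S`, followed by `v`. -/
def withParams (S : Set M) {γ : Type w} (v : γ → M) : S ⊕ γ → M :=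
  Sum.elim (fun s => (s : M)) v

@[simp] lemma withParams_inl {N : Type u} {S : Set N} {γ : Type w} (v : γ → N) (s : S) :
    withParams S v (.inl s) = s := rfl

lemma mk_sum_countable_lt (hM : IsMonsterABA M κ) {S : Set M} (hS : #S < κ) (γ : Type)
    [Countable γ] : #(S ⊕ γ) < κ := by
  rw [Cardinal.mk_sum]
  refine Cardinal.add_lt_of_lt hM.uncountable.le (by simpa using hS) ?_
  refine lt_of_le_of_lt ?_ hM.uncountable
  rw [Cardinal.lift_le_aleph0]
  exact Cardinal.mk_le_aleph0

lemma mk_union_range_lt (hM : IsMonsterABA M κ) {S : Set M} (hS : #S < κ) {n : ℕ} (a : Fin n → M) :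
    #(S ∪ Set.range a : Set M) < κ := by
  refine (Cardinal.mk_union_le _ _).trans_lt (Cardinal.add_lt_of_lt hM.uncountable.le hS ?_)
  exact (Set.finite_range a).lt_aleph0.trans hM.uncountable

lemma formula_iff_of_sameVanishing (hM : IsMonsterABA M κ) {S : Set M} (hS : #S < κ) {γ : Type}
    [Countable γ] {v w : γ → M} (h : SameVanishing (withParams S v) (withParams S w))
    (φ : boolLang[[S]].Formula γ) : φ.Realize v ↔ φ.Realize w := by
  rw [realize_iff_constantsVarsEquiv, realize_iff_constantsVarsEquiv]
  exact h.formula_iff hM (mk_sum_countable_lt hM hS γ) _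

lemma sameVanishing_of_formula_iff {S : Set M} {γ : Type w} {v w : γ → M}
    (h : ∀ φ : boolLang[[S]].Formula γ, φ.Realize v ↔ φ.Realize w) :
    SameVanishing (withParams S v) (withParams S w) := by
  intro t
  obtain ⟨φ, hφ⟩ := exists_formula_realize_iff (M := M) (t.equal botTerm)
  have := (hφ v).symm.trans ((h φ).trans (hφ w))
  rwa [Language.Formula.realize_equal, Language.Formula.realize_equal] at this

lemma tp_eq_iff_sameVanishing [Nonempty M] (hM : IsMonsterABA M κ) {S : Set M} (hS : #S < κ)
    {n : ℕ} {a a' : Fin n → M} :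
    tp boolLang S a = tp boolLang S a' ↔ SameVanishing (withParams S a) (withParams S a') :=
  (tp_eq_iff S).trans
    ⟨sameVanishing_of_formula_iff, fun h => formula_iff_of_sameVanishing hM hS h⟩

lemma indiscernibleOver_iff_sameVanishing (hM : IsMonsterABA M κ) {S : Set M} (hS : #S < κ) {m : ℕ}
    {b : ℕ → Fin m → M} :
    IndiscernibleOver boolLang S b ↔ ∀ (k : ℕ) (i j : Fin k ↪o ℕ),
      SameVanishing (withParams S fun p : Fin k × Fin m => b (i p.1) p.2)
        (withParams S fun p : Fin k × Fin m => b (j p.1) p.2) :=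
  forall₃_congr fun _ _ _ =>
    ⟨sameVanishing_of_formula_iff, fun h => formula_iff_of_sameVanishing hM hS h⟩

end Types

/-! ### Pushouts of Boolean algebras -/

section Pushout

/-- The Boolean prime ideal theorem, for homomorphisms to the two-element algebra. -/
lemma exists_hom_prop_of_bot_notMem {X : Type u} [BooleanAlgebra X] (F : Order.PFilter X)
    (hF : ⊥ ∉ F) : ∃ p : BoundedLatticeHom X Prop, ∀ x ∈ F, p x := by
  have hdisj : Disjoint (F : Set X) ((Order.Ideal.principal ⊥ : Order.Ideal X) : Set X) := by
    rw [Set.disjoint_left]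
    intro x hx hx'
    rw [SetLike.mem_coe, Order.Ideal.mem_principal, le_bot_iff] at hx'
    exact hF (hx' ▸ hx)
  obtain ⟨J, hJ, -, hFJ⟩ := DistribLattice.prime_ideal_of_disjoint_filter_ideal hdisj
  refine ⟨{ toFun := fun x => x ∉ J, map_sup' := ?_, map_inf' := ?_, map_top' := ?_,
            map_bot' := ?_ }, fun x hx => Set.disjoint_left.1 hFJ hx⟩
  · intro x y
    simp only [Order.Ideal.sup_mem_iff, sup_Prop_eq, eq_iff_iff]
    tauto
  · intro x y
    simp only [inf_Prop_eq, eq_iff_iff]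
    refine ⟨fun h => ⟨fun hx => h (J.lower inf_le_left hx), fun hy => h (J.lower inf_le_right hy)⟩,
      fun h hxy => ?_⟩
    exact (hJ.mem_or_mem hxy).elim h.1 h.2
  · exact eq_true hJ.toIsProper.top_notMem
  · exact eq_false fun h => h J.bot_mem

lemma exists_hom_prop_of_ne_bot {X : Type u} [BooleanAlgebra X] {x : X} (hx : x ≠ ⊥) :
    ∃ p : BoundedLatticeHom X Prop, p x := by
  obtain ⟨p, hp⟩ := exists_hom_prop_of_bot_notMem (Order.PFilter.principal x)
    (fun h => hx (le_bot_iff.1 (Order.PFilter.mem_principal.1 h)))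
  exact ⟨p, hp x (Order.PFilter.mem_principal.2 le_rfl)⟩

variable {M : Type u} [BooleanAlgebra M] {A B C : BooleanSubalgebra M}

/-- Two ultrafilters on `A` and `B` which agree on `C` have a common extension, if any two disjoint
elements of `A` and `B` are separated by an element of `C`. -/
lemma exists_hom_prop_extending (hA : C ≤ A) (hB : C ≤ B)
    (hsep : ∀ a ∈ A, ∀ b ∈ B, a ⊓ b = ⊥ → ∃ c ∈ C, a ≤ c ∧ b ⊓ c = ⊥)
    (p : BoundedLatticeHom A Prop) (q : BoundedLatticeHom B Prop)
    (hpq : ∀ c : C, p (BooleanSubalgebra.inclusion hA c) = q (BooleanSubalgebra.inclusion hB c)) :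
    ∃ r : BoundedLatticeHom M Prop, (∀ a : A, r a = p a) ∧ ∀ b : B, r b = q b := by
  let F : Set M := {m | ∃ a : A, ∃ b : B, p a ∧ q b ∧ (a : M) ⊓ b ≤ m}
  have hF : Order.IsPFilter F := by
    refine Order.IsPFilter.of_def ⟨⊤, ⊤, ⊤, by simp, by simp, le_top⟩ ?_ ?_
    · rintro x ⟨a, b, ha, hb, hx⟩ y ⟨a', b', ha', hb', hy⟩
      refine ⟨(a : M) ⊓ b ⊓ (a' ⊓ b'), ⟨a ⊓ a', b ⊓ b', ?_, ?_, ?_⟩, inf_le_left.trans hx,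
        inf_le_right.trans hy⟩
      · rw [map_inf]; exact ⟨ha, ha'⟩
      · rw [map_inf]; exact ⟨hb, hb'⟩
      · exact (inf_inf_inf_comm _ _ _ _).le
    · rintro x y hxy ⟨a, b, ha, hb, hx⟩
      exact ⟨a, b, ha, hb, hx.trans hxy⟩
  have hbot : ⊥ ∉ hF.toPFilter := by
    rintro ⟨a, b, ha, hb, hx⟩
    obtain ⟨c, hc, hac, hbc⟩ := hsep a a.2 b b.2 (le_bot_iff.1 hx)
    have h₁ : p (BooleanSubalgebra.inclusion hA ⟨c, hc⟩) :=
      OrderHomClass.mono p (show a ≤ BooleanSubalgebra.inclusion hA ⟨c, hc⟩ from hac) ha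
    rw [hpq] at h₁
    have h₂ : q (b ⊓ BooleanSubalgebra.inclusion hB ⟨c, hc⟩) := by
      rw [map_inf]; exact ⟨hb, h₁⟩
    rw [show b ⊓ BooleanSubalgebra.inclusion hB ⟨c, hc⟩ = ⊥ from Subtype.ext hbc, map_bot] at h₂
    exact h₂
  obtain ⟨r, hr⟩ := exists_hom_prop_of_bot_notMem _ hbot
  -- an inclusion between ultrafilters is an equality
  have hrA (a : A) (ha : p a) : r a := hr _ ⟨a, ⊤, ha, by simp, inf_le_left⟩
  have hrB (b : B) (hb : q b) : r b := hr _ ⟨⊤, b, by simp, hb, inf_le_right⟩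
  refine ⟨r, fun a => propext ⟨fun h => ?_, hrA a⟩, fun b => propext ⟨fun h => ?_, hrB b⟩⟩
  · by_contra h'
    have := hrA aᶜ (by rw [map_compl']; exact h')
    rw [show ((aᶜ : A) : M) = (a : M)ᶜ from rfl, map_compl'] at this
    exact this h
  · by_contra h'
    have := hrB bᶜ (by rw [map_compl']; exact h')
    rw [show ((bᶜ : B) : M) = (b : M)ᶜ from rfl, map_compl'] at this
    exact this h

/-- If any two disjoint elements of `A` and `B` are separated by an element of `C`, homomorphisms on
`A` and `B` which agree on `C` have a common extension to `⟨A ∪ B⟩`. Its graph is the subalgebra `G`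
generated by the two given graphs: `(⊥, x) ∈ G` forces `x = ⊥`, as otherwise an ultrafilter
containing `x` would pull back to ultrafilters on `A` and `B` without common extension. -/
lemma exists_hom_closure (hA : C ≤ A) (hB : C ≤ B)
    (hsep : ∀ a ∈ A, ∀ b ∈ B, a ⊓ b = ⊥ → ∃ c ∈ C, a ≤ c ∧ b ⊓ c = ⊥)
    {X : Type v} [BooleanAlgebra X] (f : BoundedLatticeHom A X) (g : BoundedLatticeHom B X)
    (hfg : ∀ c : C, f (BooleanSubalgebra.inclusion hA c) = g (BooleanSubalgebra.inclusion hB c)) :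
    ∃ h : BoundedLatticeHom (BooleanSubalgebra.closure ((A : Set M) ∪ B)) X,
      (∀ (a : M) (ha : a ∈ A), h ⟨a, BooleanSubalgebra.subset_closure (.inl ha)⟩ = f ⟨a, ha⟩) ∧
      ∀ (b : M) (hb : b ∈ B), h ⟨b, BooleanSubalgebra.subset_closure (.inr hb)⟩ = g ⟨b, hb⟩ := by
  let G : BooleanSubalgebra (M × X) := BooleanSubalgebra.closure
    ((Set.range fun a : A => ((a : M), f a)) ∪ Set.range fun b : B => ((b : M), g b))
  have hGA (a : A) : ((a : M), f a) ∈ G := BooleanSubalgebra.subset_closure (.inl ⟨a, rfl⟩)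
  have hGB (b : B) : ((b : M), g b) ∈ G := BooleanSubalgebra.subset_closure (.inr ⟨b, rfl⟩)
  have hG₀ (x : X) (hx : (⊥, x) ∈ G) : x = ⊥ := by
    by_contra hne
    obtain ⟨s, hs⟩ := exists_hom_prop_of_ne_bot hne
    obtain ⟨r, hrA, hrB⟩ := exists_hom_prop_extending hA hB hsep (s.comp f) (s.comp g)
      (fun c => congrArg s (hfg c))
    have key : ∀ z ∈ G, r z.1 = s z.2 := by
      intro z hz
      induction hz using BooleanSubalgebra.closure_bot_sup_induction with
      | mem z hz =>
        obtain ⟨a, rfl⟩ | ⟨b, rfl⟩ := hz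
        · exact hrA a
        · exact hrB b
      | bot => simp
      | sup z _ z' _ h h' => rw [Prod.fst_sup, Prod.snd_sup, map_sup, map_sup, h, h']
      | compl z _ h => 
        exact (map_compl' r z.1).trans ((congrArg _ h).trans (map_compl' s z.2).symm)
    have := key _ hx
    rw [map_bot] at this
    exact this.mpr hs
  have huniq (m : M) (x y : X) (hx : (m, x) ∈ G) (hy : (m, y) ∈ G) : x = y := by
    have hsdiff (x y : X) (hx : (m, x) ∈ G) (hy : (m, y) ∈ G) : x ≤ y := by
      refine sdiff_eq_bot_iff.1 (hG₀ _ ?_)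
      rw [← sdiff_self (a := m)]
      exact G.sdiff_mem hx hy
    exact le_antisymm (hsdiff x y hx hy) (hsdiff y x hy hx)
  have hex : ∀ m ∈ BooleanSubalgebra.closure ((A : Set M) ∪ B), ∃ x, (m, x) ∈ G := by
    intro m hm
    induction hm using BooleanSubalgebra.closure_bot_sup_induction with
    | mem m hm =>
      obtain hm | hm := hm
      · exact ⟨_, hGA ⟨m, hm⟩⟩
      · exact ⟨_, hGB ⟨m, hm⟩⟩
    | bot => exact ⟨⊥, G.bot_mem⟩
    | sup m _ m' _ h h' =>
      obtain ⟨x, hx⟩ := h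
      obtain ⟨y, hy⟩ := h'
      exact ⟨x ⊔ y, G.sup_mem hx hy⟩
    | compl m _ h =>
      obtain ⟨x, hx⟩ := h
      exact ⟨xᶜ, G.compl_mem hx⟩
  choose! φ hφ using hex
  refine ⟨{ toFun := fun m => φ m, map_sup' := ?_, map_inf' := ?_, map_top' := ?_,
            map_bot' := ?_ }, fun a ha => ?_, fun b hb => ?_⟩
  · exact fun m m' => huniq _ _ _ (hφ _ (m ⊔ m').2) (G.sup_mem (hφ _ m.2) (hφ _ m'.2))
  · exact fun m m' => huniq _ _ _ (hφ _ (m ⊓ m').2) (G.inf_mem (hφ _ m.2) (hφ _ m'.2))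
  · exact huniq _ _ _ (hφ _ BooleanSubalgebra.top_mem) G.top_mem
  · exact huniq _ _ _ (hφ _ BooleanSubalgebra.bot_mem) G.bot_mem
  · exact huniq _ _ _ (hφ a (BooleanSubalgebra.subset_closure (.inl ha))) (hGA ⟨a, ha⟩)
  · exact huniq _ _ _ (hφ b (BooleanSubalgebra.subset_closure (.inr hb))) (hGB ⟨b, hb⟩)

lemma hom_closure_ext {X : Type v} [BooleanAlgebra X]
    {h h' : BoundedLatticeHom (BooleanSubalgebra.closure ((A : Set M) ∪ B)) X}
    (hA : ∀ (a : M) (ha : a ∈ A), h ⟨a, BooleanSubalgebra.subset_closure (.inl ha)⟩ =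
      h' ⟨a, BooleanSubalgebra.subset_closure (.inl ha)⟩)
    (hB : ∀ (b : M) (hb : b ∈ B), h ⟨b, BooleanSubalgebra.subset_closure (.inr hb)⟩ =
      h' ⟨b, BooleanSubalgebra.subset_closure (.inr hb)⟩) : h = h' := by
  ext ⟨m, hm⟩
  induction hm using BooleanSubalgebra.closure_bot_sup_induction with
  | mem m hm =>
    obtain hm | hm := hm
    · exact hA m hm
    · exact hB m hm
  | bot => exact (map_bot h).trans (map_bot h').symm
  | sup m hm m' hm' h₁ h₂ =>
    let z : BooleanSubalgebra.closure ((A : Set M) ∪ B) := ⟨m, hm⟩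
    let z' : BooleanSubalgebra.closure ((A : Set M) ∪ B) := ⟨m', hm'⟩
    exact (map_sup h z z').trans ((congrArg₂ _ h₁ h₂).trans (map_sup h' z z').symm)
  | compl m hm h₁ =>
    let z : BooleanSubalgebra.closure ((A : Set M) ∪ B) := ⟨m, hm⟩
    exact (map_compl' h z).trans ((congrArg _ h₁).trans (map_compl' h' z).symm)

lemma freelyAmalgamated_of_separated (hA : C ≤ A) (hB : C ≤ B)
    (hsep : ∀ a ∈ A, ∀ b ∈ B, a ⊓ b = ⊥ → ∃ c ∈ C, a ≤ c ∧ b ⊓ c = ⊥) :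
    FreelyAmalgamated hA hB := by
  refine IsPushout.of_isColimit' ⟨rfl⟩ (Limits.PushoutCocone.IsColimit.mk _
    (fun s => BoolAlg.ofHom (exists_hom_closure hA hB hsep s.inl.hom s.inr.hom
      (fun c => congrArg (fun k => k.hom c) s.condition)).choose) ?_ ?_ ?_)
  · intro s
    ext a
    exact (exists_hom_closure hA hB hsep s.inl.hom s.inr.hom
      (fun c => congrArg (fun k => k.hom c) s.condition)).choose_spec.1 a a.2
  · intro s
    ext b
    exact (exists_hom_closure hA hB hsep s.inl.hom s.inr.hom
      (fun c => congrArg (fun k => k.hom c) s.condition)).choose_spec.2 b b.2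
  · intro s m hmA hmB
    have hs := (exists_hom_closure hA hB hsep s.inl.hom s.inr.hom
      (fun c => congrArg (fun k => k.hom c) s.condition)).choose_spec
    refine BoolAlg.hom_ext (hom_closure_ext (fun a ha => ?_) fun b hb => ?_)
    · exact (congrArg (fun k => k.hom ⟨a, ha⟩) hmA).trans (hs.1 a ha).symm
    · exact (congrArg (fun k => k.hom ⟨b, hb⟩) hmB).trans (hs.2 b hb).symm

/-- Below each atom of `C`, the algebras `A` and `B` are independent: elements which both meet the
atom meet each other. -/
def AtomwiseIndependent (C A B : BooleanSubalgebra M) : Prop :=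
  ∀ c : C, IsAtom c → ∀ a ∈ A, ∀ b ∈ B, a ⊓ c ≠ ⊥ → b ⊓ c ≠ ⊥ → a ⊓ b ≠ ⊥

/-- Ultrafilters on `A` and `B` containing the same atom `c` of `C` agree on `C`, so that they
induce an ultrafilter on the pushout. -/
lemma FreelyAmalgamated.atomwiseIndependent {hA : C ≤ A} {hB : C ≤ B}
    (h : FreelyAmalgamated hA hB) : AtomwiseIndependent C A B := by
  intro c hc a ha b hb hac hbc hab
  let c₁ : A := BooleanSubalgebra.inclusion hA c
  let c₂ : B := BooleanSubalgebra.inclusion hB c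
  obtain ⟨p, hp⟩ := exists_hom_prop_of_ne_bot (X := A) (x := ⟨a, ha⟩ ⊓ c₁)
    (fun h => hac (congrArg Subtype.val h))
  obtain ⟨q, hq⟩ := exists_hom_prop_of_ne_bot (X := B) (x := ⟨b, hb⟩ ⊓ c₂)
    (fun h => hbc (congrArg Subtype.val h))
  rw [map_inf] at hp hq
  have hpq (d : C) : p (BooleanSubalgebra.inclusion hA d) =
      q (BooleanSubalgebra.inclusion hB d) := by
    have hval (r : BoundedLatticeHom C Prop) (hr : r c) : r d ↔ c ≤ d := by
      refine ⟨fun h => ?_, fun h => OrderHomClass.mono r h hr⟩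
      by_contra hcd
      have : r (c ⊓ d) := by rw [map_inf]; exact ⟨hr, h⟩
      rw [(hc.not_le_iff_disjoint.1 hcd).eq_bot, map_bot] at this
      exact this
    exact propext ((hval (p.comp (BooleanSubalgebra.inclusion hA)) hp.2).trans
      (hval (q.comp (BooleanSubalgebra.inclusion hB)) hq.2).symm)
  -- the pushout property concerns algebras in `Type u` only, so `Prop` is replaced by a copy there
  let ι : BoundedLatticeHom Prop (Set PUnit.{u + 1}) :=
    { toFun := fun P => {_x | P}, map_sup' := fun _ _ => rfl, map_inf' := fun _ _ => rfl,
      map_top' := rfl, map_bot' := rfl }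
  have hcomm := BoolAlg.hom_ext (f := BoolAlg.ofHom (BooleanSubalgebra.inclusion hA) ≫
      BoolAlg.ofHom (ι.comp p)) (g := BoolAlg.ofHom (BooleanSubalgebra.inclusion hB) ≫
      BoolAlg.ofHom (ι.comp q)) (BoundedLatticeHom.ext fun d => congrArg ι (hpq d))
  have hkA := congrArg (fun k => k.hom ⟨a, ha⟩) (h.inl_desc _ _ hcomm)
  have hkB := congrArg (fun k => k.hom ⟨b, hb⟩) (h.inr_desc _ _ hcomm)
  let a' : BooleanSubalgebra.closure ((A : Set M) ∪ B) :=
    ⟨a, BooleanSubalgebra.subset_closure (.inl ha)⟩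
  let b' : BooleanSubalgebra.closure ((A : Set M) ∪ B) :=
    ⟨b, BooleanSubalgebra.subset_closure (.inr hb)⟩
  let k : BoundedLatticeHom (BooleanSubalgebra.closure ((A : Set M) ∪ B)) (Set PUnit.{u + 1}) :=
    (h.desc _ _ hcomm).hom
  have hk : k (a' ⊓ b') = k a' ⊓ k b' := map_inf k a' b'
  rw [show a' ⊓ b' = ⊥ from Subtype.ext hab, map_bot] at hk
  have hbot : ι (p ⟨a, ha⟩) ⊓ ι (q ⟨b, hb⟩) = ⊥ :=
    (congrArg₂ (· ⊓ ·) hkA hkB).symm.trans hk.symm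
  have hmem : PUnit.unit ∈ (ι (p ⟨a, ha⟩) ⊓ ι (q ⟨b, hb⟩)) := ⟨hp.1, hq.1⟩
  rw [hbot] at hmem
  exact hmem

lemma inf_ne_bot_of_le_isLeast {a e c : M} (he : IsLeast {c | c ∈ C ∧ a ≤ c} e) (hc : c ∈ C)
    (hce : c ≤ e) (hc₀ : c ≠ ⊥) : a ⊓ c ≠ ⊥ := by
  intro h
  have h₁ : e ≤ cᶜ := he.2 ⟨C.compl_mem hc, (disjoint_iff.2 h).le_compl_right⟩
  exact hc₀ (by simpa using le_inf le_rfl (hce.trans h₁))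

/-- Over an atomic `C`, an element `b` of `B` is disjoint from `a` only if it is disjoint from the
least element of `C` above `a`. -/
lemma AtomwiseIndependent.inf_eq_bot_iff [hat : IsAtomic C] (h : AtomwiseIndependent C A B)
    (hCB : SitsNicely C B) {a b e : M} (ha : a ∈ A) (hb : b ∈ B)
    (he : IsLeast {c | c ∈ C ∧ a ≤ c} e) : a ⊓ b = ⊥ ↔ e ⊓ b = ⊥ := by
  refine ⟨fun hab => ?_, fun heb => le_bot_iff.1 ((inf_le_inf_right b he.1.2).trans heb.le)⟩
  obtain ⟨e', he'⟩ := hCB.exists_least b hb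
  by_contra hne
  have hee' : (⟨e, he.1.1⟩ ⊓ ⟨e', he'.1.1⟩ : C) ≠ ⊥ := fun h₀ =>
    hne (le_bot_iff.1 ((inf_le_inf_left e he'.1.2).trans (congrArg Subtype.val h₀).le))
  obtain ⟨c, hc, hce⟩ := (eq_bot_or_exists_atom_le _).resolve_left hee'
  have hc₀ : (c : M) ≠ ⊥ := fun h₀ => hc.1 (Subtype.ext h₀)
  exact h c hc a ha b hb (inf_ne_bot_of_le_isLeast he c.2 (hce.trans inf_le_left) hc₀)
    (inf_ne_bot_of_le_isLeast he' c.2 (hce.trans inf_le_right) hc₀) hab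

/-- Over an atomic subalgebra, free amalgamation means independence below each atom. -/
theorem freelyAmalgamated_iff_atomwiseIndependent [IsAtomic C] (hCA : SitsNicely C A)
    (hCB : SitsNicely C B) :
    FreelyAmalgamated hCA.le hCB.le ↔ AtomwiseIndependent C A B := by
  refine ⟨fun h => h.atomwiseIndependent, fun h => freelyAmalgamated_of_separated _ _ ?_⟩
  intro a ha b hb hab
  obtain ⟨e, he⟩ := hCA.exists_least a ha
  exact ⟨e, he.1.1, he.1.2, inf_comm b e ▸ (h.inf_eq_bot_iff hCB ha hb he).1 hab⟩

end Pushout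

/-! ### Independence below atoms implies dividing independence -/

section DividingIndependence

variable {M : Type u} [BooleanAlgebra M] {κ : Cardinal.{u}} {A B C : BooleanSubalgebra M}

/-- Let `e` and `f` be the least elements of `C` above `a` and `aᶜ`. The new element `a'` is chosen
between `fᶜ` and `e` and splits every nonzero element below `e ⊓ f` that is spanned by `C` and the
sequence. Then `a'` meets such an element if and only if `e` does, which is a condition over `C`. -/
lemma AtomwiseIndependent.divIndep [Nonempty M] [IsAtomic C] (hM : IsMonsterABA M κ)
    (hC : #C < κ) (hCA : SitsNicely C A) (hCB : SitsNicely C B) (h : AtomwiseIndependent C A B)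
    {a b : M} (ha : a ∈ A) (hb : b ∈ B) : DivIndep boolLang (C : Set M) ![a] ![b] := by
  classical
  intro s hs hs₀
  obtain ⟨e, he⟩ := hCA.exists_least a ha
  obtain ⟨f, hf⟩ := hCA.exists_least aᶜ (A.compl_mem ha)
  let w : (C : Set M) ⊕ ℕ → M := withParams (C : Set M) fun i => s i 0
  have hsup (x : M) : ∀ d ∈ spanTuple w, ∀ d' ∈ spanTuple w,
      x ⊓ (d ⊔ d') = ⊥ ↔ x ⊓ d = ⊥ ∧ x ⊓ d' = ⊥ := fun d _ d' _ => by
    rw [inf_sup_left, sup_eq_bot_iff]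
  obtain ⟨a', ha'⟩ := exists_cut hM w (mk_sum_countable_lt hM hC ℕ) (P := fun d => e ⊓ d = ⊥)
    (Q := fun d => f ⊓ d = ⊥) (hsup e) (hsup f) (inf_bot_eq _) (inf_bot_eq _) (fun d _ h₁ h₂ => by
      have hef : e ⊔ f = ⊤ := top_le_iff.1 (sup_compl_eq_top.ge.trans (sup_le_sup he.1.2 hf.1.2))
      rw [← top_inf_eq d, ← hef, inf_sup_right, h₁, h₂, sup_bot_eq])
  have hwC {c : M} (hc : c ∈ C) : c ∈ spanTuple w := ⟨.var (.inl ⟨c, hc⟩), rfl⟩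
  have hws (i : ℕ) (l : Fin 1) : s i l ∈ spanTuple w :=
    ⟨.var (.inr i), congrArg (s i) (Subsingleton.elim _ _)⟩
  refine ⟨![a'], (tp_eq_iff_sameVanishing hM (mk_union_range_lt hM hC _)).2 ?_,
    (indiscernibleOver_iff_sameVanishing hM (mk_union_range_lt hM hC _)).2 fun k i j => ?_⟩
  · let S : Set M := C ∪ Set.range ![b]
    let g : S ⊕ Fin 1 → Option S := Sum.elim some fun _ => none
    have hg (x : M) : withParams S ![x] = fun y => (g y).elim x Subtype.val := by
      funext y
      rcases y with y | l
      · rfl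
      · rw [Subsingleton.elim l 0]; rfl
    change SameVanishing (withParams S ![a']) (withParams S ![a])
    rw [hg, hg]
    refine sameVanishing_of_split g fun t => ?_
    have hw : t.realize (Subtype.val : S → M) ∈ spanTuple w := by
      refine realize_mem ?_ t
      rintro ⟨x, hx | ⟨l, rfl⟩⟩
      · exact hwC hx
      · change ![b] l ∈ spanTuple w
        rw [← hs₀]
        exact hws 0 l
    have hB : t.realize (Subtype.val : S → M) ∈ B := by
      refine realize_mem ?_ t
      rintro ⟨x, hx | ⟨l, rfl⟩⟩
      · exact hCB.le hx
      · rw [Subsingleton.elim l 0]; exact hb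
    rw [(ha' _ hw).1, (ha' _ hw).2, h.inf_eq_bot_iff hCB ha hB he,
      h.inf_eq_bot_iff hCB (A.compl_mem ha) hB hf]
    exact ⟨Iff.rfl, Iff.rfl⟩
  · let S : Set M := C ∪ Set.range ![a']
    let g : S ⊕ (Fin k × Fin 1) → Option ((C : Set M) ⊕ (Fin k × Fin 1)) :=
      Sum.elim (fun y => if hy : (y : M) ∈ C then some (.inl ⟨y, hy⟩) else none)
        fun p => some (.inr p)
    have hg (v : Fin k × Fin 1 → M) :
        withParams S v = fun y => (g y).elim a' (withParams (C : Set M) v) := by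
      funext y
      rcases y with ⟨y, hy⟩ | l
      · by_cases hyC : y ∈ C
        · simp only [g, Sum.elim_inl, hyC, dite_true, Option.elim_some, withParams_inl]
        · obtain ⟨l, rfl⟩ : ∃ l : Fin 1, ![a'] l = y := hy.resolve_left hyC
          simp only [g, Sum.elim_inl, hyC, dite_false, Option.elim_none, withParams_inl]
          exact congrArg ![a'] (Subsingleton.elim l 0)
      · rfl
    change SameVanishing (withParams S _) (withParams S _)
    rw [hg, hg]
    have hw (i : Fin k ↪o ℕ) (t : boolLang.Term ((C : Set M) ⊕ (Fin k × Fin 1))) :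
        t.realize (withParams (C : Set M) fun p => s (i p.1) p.2) ∈ spanTuple w := by
      refine realize_mem ?_ t
      rintro (c | p)
      · exact hwC c.2
      · exact hws _ _
    have hsC := (indiscernibleOver_iff_sameVanishing hM hC).1 hs k i j
    refine sameVanishing_of_split g fun t => ?_
    rw [(ha' _ (hw i t)).1, (ha' _ (hw i t)).2, (ha' _ (hw j t)).1, (ha' _ (hw j t)).2]
    exact ⟨hsC (infTerm (.var (.inl ⟨e, he.1.1⟩)) t), hsC (infTerm (.var (.inl ⟨f, hf.1.1⟩)) t)⟩

/-! ### Dividing below an atom -/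

lemma exists_pairwise_disjoint_seq (hM : ∀ x : M, ¬ IsAtom x) {b c : M} (hbc : b ≤ c)
    (hb : b ≠ ⊥) (hcb : c \ b ≠ ⊥) :
    ∃ e : ℕ → M, (∀ i, e i ≠ ⊥) ∧ (∀ i, e i ≤ c) ∧
      Pairwise (Function.onFun Disjoint e) ∧ e 0 = c \ b := by
  choose! half hhalf using fun (x : M) (hx : x ≠ ⊥) => exists_lt_lt_of_atomless hM hx
  let r : ℕ → M := fun n => half^[n] b
  have hr_succ (n : ℕ) : r (n + 1) = half (r n) := Function.iterate_succ_apply' _ _ _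
  have hr (n : ℕ) : r n ≠ ⊥ := by
    induction n with
    | zero => exact hb
    | succ n ih => rw [hr_succ]; exact (hhalf _ ih).1
  have hlt (n : ℕ) : r (n + 1) < r n := by rw [hr_succ]; exact (hhalf _ (hr n)).2
  have hanti : Antitone r := antitone_nat_of_succ_le fun n => (hlt n).le
  let e : ℕ → M := fun n => Nat.casesOn n (c \ b) fun n => r n \ r (n + 1)
  have hdisj (n : ℕ) : Disjoint (e n) (r n) := by
    cases n with
    | zero => exact disjoint_sdiff_self_left
    | succ n => exact disjoint_sdiff_self_left
  have hle (n : ℕ) : e (n + 1) ≤ r n := sdiff_le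
  refine ⟨e, fun n => ?_, fun n => ?_, ?_, rfl⟩
  · cases n with
    | zero => exact hcb
    | succ n => exact fun h => (hlt n).not_ge (sdiff_eq_bot_iff.1 h)
  · cases n with
    | zero => exact sdiff_le
    | succ n => exact (hle n).trans ((hanti n.zero_le).trans hbc)
  · refine (Std.Symm.pairwise_on (r := Disjoint) e).2 fun m n hmn => ?_
    obtain ⟨n, rfl⟩ := Nat.exists_eq_succ_of_ne_zero (Nat.ne_zero_of_lt hmn)
    exact (hdisj m).mono_right ((hle n).trans (hanti (Nat.lt_succ_iff.1 hmn)))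

/-- The complements in an atom `c` of `C` of the members of a disjoint sequence below `c` form an
indiscernible sequence over `C`: finitely many members of the disjoint sequence and the rest of `c`
partition `c` into nonzero pieces, and on each piece the value of a term over `C` is determined by
the positions of the members in question. -/
lemma indiscernibleOver_sdiff_of_isAtom (hM : IsMonsterABA M κ) (hC : #C < κ) {c : C}
    (hc : IsAtom c) {e : ℕ → M} (he₀ : ∀ i, e i ≠ ⊥) (hec : ∀ i, e i ≤ c)
    (hdisj : Pairwise (Function.onFun Disjoint e)) :
    IndiscernibleOver boolLang (C : Set M) fun i => ![(c : M) \ e i] := by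
  classical
  refine (indiscernibleOver_iff_sameVanishing hM hC).2 fun k i j => ?_
  let V (i : Fin k ↪o ℕ) : (C : Set M) ⊕ (Fin k × Fin 1) → M :=
    withParams (C : Set M) fun p => ![(c : M) \ e (i p.1)] p.2
  change SameVanishing (V i) (V j)
  -- the two-valued assignment describing a piece inside `e (i l)` exactly for those `l` with `q l`
  let ν (q : Fin k → Prop) : (C : Set M) ⊕ (Fin k × Fin 1) → M :=
    Sum.elim (fun d => if (c : M) ≤ d then ⊤ else ⊥) fun p => if q p.1 then ⊥ else ⊤
  have hν (q) (t : boolLang.Term ((C : Set M) ⊕ (Fin k × Fin 1))) :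
      t.realize (ν q) = ⊥ ∨ t.realize (ν q) = ⊤ := by
    refine realize_eq_bot_or_eq_top ?_ t
    rintro (d | p) <;> simp only [ν, Sum.elim_inl, Sum.elim_inr] <;> split_ifs <;> simp
  have hpiece (i : Fin k ↪o ℕ) (q : Fin k → Prop) (x : M) (hx₀ : x ≠ ⊥) (hxc : x ≤ c)
      (hx₁ : ∀ l, q l → x ≤ e (i l)) (hx₂ : ∀ l, ¬ q l → Disjoint x (e (i l)))
      (t : boolLang.Term ((C : Set M) ⊕ (Fin k × Fin 1))) :
      Disjoint (t.realize (V i)) x ↔ t.realize (ν q) = ⊥ := by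
    rw [disjoint_iff, realize_inf_congr (w := ν q) (p := x) ?_ t]
    · rcases hν q t with h | h
      · simp [h]
      · have : Nontrivial M := hM.nontrivial
        simp [h, hx₀]
    rintro (d | ⟨l, m⟩)
    · change (d : M) ⊓ x = (if (c : M) ≤ d then ⊤ else ⊥) ⊓ x
      split_ifs with hcd
      · rw [inf_eq_right.2 (hxc.trans hcd), top_inf_eq]
      · have : Disjoint c (⟨d, d.2⟩ : C) := hc.not_le_iff_disjoint.1 hcd
        have : Disjoint (c : M) d := disjoint_iff.2 (congrArg Subtype.val this.eq_bot)
        rw [(this.mono_left hxc).symm.eq_bot, bot_inf_eq]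
    · rw [Subsingleton.elim m 0]
      change ((c : M) \ e (i l)) ⊓ x = (if q l then ⊥ else ⊤) ⊓ x
      split_ifs with hq
      · rw [(disjoint_sdiff_self_left.mono_right (hx₁ l hq)).eq_bot, bot_inf_eq]
      · rw [top_inf_eq, inf_eq_right, le_sdiff]
        exact ⟨hxc, hx₂ l hq⟩
  let v₀ : (C : Set M) ⊕ (Fin k × Fin 1) → M := withParams (C : Set M) fun _ => ⊥
  -- the right-hand side does not mention `i`
  have key (i : Fin k ↪o ℕ) (t : boolLang.Term ((C : Set M) ⊕ (Fin k × Fin 1))) :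
      t.realize (V i) = ⊥ ↔ t.realize v₀ ⊓ (c : M)ᶜ = ⊥ ∧
        (∀ l, t.realize (ν fun l' => l' = l) = ⊥) ∧ t.realize (ν fun _ => False) = ⊥ := by
    let m : M := Finset.univ.sup fun l => e (i l)
    have hmc : m ≤ c := Finset.sup_le fun l _ => hec _
    have htop : (c : M)ᶜ ⊔ (m ⊔ c \ m) = ⊤ := by
      rw [sup_sdiff_cancel_right hmc, sup_comm, sup_compl_eq_top]
    have hrest : (c : M) \ m ≠ ⊥ := by
      obtain ⟨n, hn⟩ := (Set.finite_range i).exists_notMem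
      refine ne_bot_of_le_ne_bot (he₀ n) (le_sdiff.2 ⟨hec n, ?_⟩)
      exact Finset.disjoint_sup_right.2 fun l _ => hdisj fun h => hn ⟨l, h.symm⟩
    rw [← disjoint_top, ← htop, disjoint_sup_right, disjoint_sup_right,
      hpiece i (fun _ => False) _ hrest sdiff_le (fun _ h => h.elim) (fun l _ =>
        disjoint_sdiff_self_left.mono_right (Finset.le_sup (f := fun l => e (i l))
          (Finset.mem_univ l))), Finset.disjoint_sup_right, disjoint_iff,
      realize_inf_congr (w := v₀) (p := (c : M)ᶜ) ?_ t]
    · refine and_congr_right fun _ => and_congr_left fun _ => ?_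
      simp only [Finset.mem_univ, true_imp_iff]
      refine forall_congr' fun l => hpiece i _ _ (he₀ _) (hec _) (fun _ h => h ▸ le_rfl)
        (fun l' h => hdisj fun h' => h (i.injective h').symm) t
    · rintro (d | ⟨l, m⟩)
      · rfl
      · rw [Subsingleton.elim m 0]
        change ((c : M) \ e (i l)) ⊓ (c : M)ᶜ = ⊥ ⊓ (c : M)ᶜ
        rw [bot_inf_eq, (disjoint_compl_right.mono_left sdiff_le).eq_bot]
  exact fun t => (key i t).trans (key j t).symm

/-- Below an atom `c` of `C`, being a nonzero element disjoint from `b` divides over `C`: there is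
an indiscernible sequence starting at `b` whose complements in `c` are pairwise disjoint. -/
lemma not_divIndep_of_isAtom [Nonempty M] (hM : IsMonsterABA M κ) (hC : #C < κ) {c : C}
    (hc : IsAtom c) {a b : M} (ha₀ : a ≠ ⊥) (hb₀ : b ≠ ⊥) (hac : a ≤ c) (hbc : b ≤ c)
    (hab : a ⊓ b = ⊥) : ¬ DivIndep boolLang (C : Set M) ![a] ![b] := by
  intro h
  have hcb : (c : M) \ b ≠ ⊥ :=
    ne_bot_of_le_ne_bot ha₀ (le_sdiff.2 ⟨hac, disjoint_iff.2 hab⟩)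
  obtain ⟨e, he₀, hec, hdisj, he⟩ := exists_pairwise_disjoint_seq hM.atomless hbc hb₀ hcb
  have hb : (c : M) \ e 0 = b := by rw [he, sdiff_sdiff_eq_self hbc]
  obtain ⟨a', htp, hind⟩ := h (fun i => ![(c : M) \ e i])
    (indiscernibleOver_sdiff_of_isAtom hM hC hc he₀ hec hdisj) (by rw [hb])
  rw [tp_eq_iff_sameVanishing hM (mk_union_range_lt hM hC _)] at htp
  rw [indiscernibleOver_iff_sameVanishing hM (mk_union_range_lt hM hC _)] at hind
  have ha'₀ : a' 0 ≠ ⊥ := (htp (.var (.inr 0))).not.2 ha₀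
  have ha'c : a' 0 ⊓ (c : M)ᶜ = ⊥ :=
    (htp (infTerm (.var (.inr 0)) (complTerm (.var (.inl ⟨c, .inl c.2⟩))))).2
      (disjoint_compl_right.mono_left hac).eq_bot
  have ha'b : a' 0 ⊓ ((c : M) \ e 0) = ⊥ := by
    rw [hb]
    exact (htp (infTerm (.var (.inr 0)) (.var (.inl ⟨b, .inr ⟨0, rfl⟩⟩)))).2 hab
  let at_index (n : ℕ) : Fin 1 ↪o ℕ :=
    OrderEmbedding.ofStrictMono (fun _ => n) (Subsingleton.strictMono _)
  have ha'b₁ : a' 0 ⊓ ((c : M) \ e 1) = ⊥ :=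
    (hind 1 (at_index 0) (at_index 1)
      (infTerm (.var (.inl ⟨a' 0, .inr ⟨0, rfl⟩⟩)) (.var (.inr (0, 0))))).1 ha'b
  have hle (n : ℕ) (hn : a' 0 ⊓ ((c : M) \ e n) = ⊥) : a' 0 ≤ e n := by
    have : a' 0 ≤ c := by simpa using (disjoint_iff.2 ha'c).le_compl_right
    rw [← inf_eq_left.2 this, ← sdiff_eq_bot_iff, inf_sdiff_assoc]
    exact hn
  exact ha'₀ (le_bot_iff.1 ((hdisj (zero_ne_one (α := ℕ))) (hle 0 ha'b) (hle 1 ha'b₁)))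

end DividingIndependence

theorem theorem2 {M : Type u} [BooleanAlgebra M] {κ : Cardinal.{u}} (hM : IsMonsterABA M κ)
    (A B C : BooleanSubalgebra M) (hC : #C < κ) (hat : IsAtomic C)
    (hCA : SitsNicely C A) (hCB : SitsNicely C B) :
    FreelyAmalgamated hCA.le hCB.le ↔
      ∀ a ∈ A, ∀ b ∈ B, DivIndep boolLang (C : Set M) ![a] ![b] := by
  rw [freelyAmalgamated_iff_atomwiseIndependent hCA hCB]
  refine ⟨fun h a ha b hb => h.divIndep hM hC hCA hCB ha hb, fun h c hc a ha b hb hac hbc hab => ?_⟩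
  refine not_divIndep_of_isAtom hM hC hc hac hbc inf_le_right inf_le_right ?_
    (h _ (A.inf_mem ha (hCA.le c.2)) _ (B.inf_mem hb (hCB.le c.2)))
  rw [inf_inf_inf_comm, hab, bot_inf_eq]
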